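/- For a graph $G$ and $r \ge 4$, let $S_r(G)$ be the number of orientations of $G$ in which no copy of $K_r$ is strongly connected (that is, no $r$-clique of $G$ induces a strongly connected tournament), and let $S_r(n,p) = S_r(G(n,p))$, where $G(n,p)$ is the binomial random graph on $n$ vertices with edge probability $p = p(n) \in [0,1]$. For every $r \ge 4$ there is a constant $C = C(r) > 0$ such that the following holds. (1) If $p = p(n)$ satisfies $p / n^{-2/(r+1)} \to \infty$ as $n \to \infty$ and $p \le (\log n)^{-2/(r-2)}$ for all sufficiently large $n$, then, with probability tending to $1$ as $n \to \infty$, $$S_r(n,p) \le \exp\left( \frac{C\, n (\log n)^{1+1/(r-2)}}{p^{(r-1)/2}} \right).$$ (2) If $p = p(n)$ satisfies $p > (\log n)^{-2/(r-2)}$ for all sufficiently large $n$, then, with probability tending to $1$ as $n \to \infty$, $$S_r(n,p) \le \exp\left( \frac{C\, n (\log n)^2}{p} \right).$$ -/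

import Mathlib

open Filter Topology
open scoped SimpleGraph

/-- `D` is an orientation of the simple graph `G`: every edge of `G` receives exactly one of its
two directions, and `D` has no other arcs. -/
def IsOrientation {V : Type*} (G : SimpleGraph V) (D : Digraph V) : Prop :=
  (∀ u v, G.Adj u v ↔ D.Adj u v ∨ D.Adj v u) ∧ ∀ u v, D.Adj u v → ¬ D.Adj v u

/-- The subdigraph of `D` induced by the vertex set `S` is strongly connected: any two vertices
of `S` are joined by a directed path of `D` that stays in `S`. -/
def IsStronglyConnectedOn {V : Type*} (D : Digraph V) (S : Set V) : Prop :=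
  ∀ u v : S, Relation.ReflTransGen (fun a b : S => D.Adj a b) u v

/-- The number of orientations of `G` in which no copy of `K_r` is strongly connected. -/
noncomputable def numOrientations {V : Type*} (r : ℕ) (G : SimpleGraph V) : ℕ :=
  {D : Digraph V | IsOrientation G D ∧
    ∀ S : Finset V, G.IsNClique r S → ¬ IsStronglyConnectedOn D (S : Set V)}.ncard

/-! Put k = r - 1 and order the vertices. Let v be joined to all of a k-clique Q in which x reaches
every vertex and every vertex reaches y. If v → x and y → v, then Q ∪ {v} is strongly connected;
hence v → x forces v → y (`Forces.adj`). So the out-neighbours of v among its earlier neighbours are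
closed under a relation that depends only on arcs between earlier vertices, and a minimal generating
set encodes them. Every oriented k-clique contains a forcing pair (`exists_forces_of_isNClique`), so
minimal generating sets span no K_k. If every M-set contains a K_k, this leaves at most n^(Mn) =
exp(M n log n) orientations (`numOrientations_le_pow`).

It remains to find a small M that works with high probability. Janson's inequality
(`binomExp_prod_le_exp`) and a union bound over M-sets suffice once M^j p^(j choose 2) ≥ K M log n
for 2 ≤ j ≤ k; only j = 2 and j = k matter (`le_pow_mul_pow_choose`). They require M to be of order
log n / p and (log n)^(1/(k-1)) / p^(k/2) respectively. The two orders agree at p = (log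
n)^(-2/(k-1)), which separates the two regimes. -/

/-! ### Encoding an orientation by small generating sets. -/

/-- Reachability in the subdigraph of `D` induced by `Q`. -/
def ReachIn {V : Type*} (D : Digraph V) (Q : Finset V) : V → V → Prop :=
  Relation.ReflTransGen fun a b => a ∈ Q ∧ b ∈ Q ∧ D.Adj a b

/-- Some `k`-clique inside `L` contains `x` and `y`, and in the digraph induced by `D` on this
clique, `x` reaches every vertex and every vertex reaches `y`. -/
def Forces {V : Type*} (G : SimpleGraph V) (D : Digraph V) (k : ℕ) (L : Finset V) (x y : V) :
    Prop :=
  ∃ Q ⊆ L, G.IsNClique k Q ∧ x ∈ Q ∧ y ∈ Q ∧ ∀ z ∈ Q, ReachIn D Q x z ∧ ReachIn D Q z y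

theorem ReachIn.mono {V : Type*} {D D' : Digraph V} {Q Q' : Finset V} {x y : V}
    (h : ReachIn D Q x y) (hQ : Q ⊆ Q')
    (hD : ∀ a ∈ Q, ∀ b ∈ Q, D.Adj a b → D'.Adj a b) : ReachIn D' Q' x y :=
  Relation.ReflTransGen.mono
    (fun a b hab => ⟨hQ hab.1, hQ hab.2.1, hD a hab.1 b hab.2.1 hab.2.2⟩) _ _ h

theorem Forces.congr {V : Type*} {G : SimpleGraph V} {D D' : Digraph V} {k : ℕ} {L : Finset V}
    (hD : ∀ a ∈ L, ∀ b ∈ L, D.Adj a b → D'.Adj a b) {x y : V} (h : Forces G D k L x y) :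
    Forces G D' k L x y := by
  obtain ⟨Q, hQL, hQ, hx, hy, hz⟩ := h
  have hQD : ∀ a ∈ Q, ∀ b ∈ Q, D.Adj a b → D'.Adj a b := fun a ha b hb => hD a (hQL ha) b (hQL hb)
  exact ⟨Q, hQL, hQ, hx, hy, fun z hzQ =>
    ⟨(hz z hzQ).1.mono subset_rfl hQD, (hz z hzQ).2.mono subset_rfl hQD⟩⟩

theorem Finset.exists_forall_rel_of_total {V : Type*} (R : V → V → Prop) (hrefl : ∀ a, R a a)
    (htrans : ∀ a b c, R a b → R b c → R a c) {Q : Finset V} (hQ : Q.Nonempty)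
    (htotal : ∀ a ∈ Q, ∀ b ∈ Q, R a b ∨ R b a) : ∃ x ∈ Q, ∀ z ∈ Q, R x z := by
  induction hQ using Finset.Nonempty.cons_induction with
  | singleton a => exact ⟨a, by simp, by simpa using hrefl a⟩
  | cons a s ha hs ih =>
    obtain ⟨x, hx, hxz⟩ := ih fun b hb c hc =>
      htotal b (Finset.mem_cons_of_mem hb) c (Finset.mem_cons_of_mem hc)
    rcases htotal a (Finset.mem_cons_self a s) x (Finset.mem_cons_of_mem hx) with h | h
    · refine ⟨a, Finset.mem_cons_self a s, fun z hz => ?_⟩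
      rcases Finset.mem_cons.1 hz with rfl | hz
      · exact hrefl _
      · exact htrans _ _ _ h (hxz z hz)
    · refine ⟨x, Finset.mem_cons_of_mem hx, fun z hz => ?_⟩
      rcases Finset.mem_cons.1 hz with rfl | hz
      · exact h
      · exact hxz z hz

/-- Reachability is a total preorder on a tournament, so it has a first vertex x and a last vertex
y. If these coincide, the tournament is strongly connected and any other vertex can serve as y. -/
theorem exists_forces_of_isNClique {V : Type*} {G : SimpleGraph V} {D : Digraph V}
    (hD : IsOrientation G D) {k : ℕ} (hk : 2 ≤ k) {Q L : Finset V} (hQ : G.IsNClique k Q)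
    (hQL : Q ⊆ L) : ∃ x ∈ Q, ∃ y ∈ Q, x ≠ y ∧ Forces G D k L x y := by
  have hcard : 1 < Q.card := by rw [hQ.card_eq]; omega
  have hne : Q.Nonempty := Finset.card_pos.1 (by omega)
  have htotal : ∀ a ∈ Q, ∀ b ∈ Q, ReachIn D Q a b ∨ ReachIn D Q b a := by
    intro a ha b hb
    by_cases hab : a = b
    · exact .inl (hab ▸ Relation.ReflTransGen.refl)
    · rcases (hD.1 a b).1 (hQ.isClique ha hb hab) with h | h
      · exact .inl (.single ⟨ha, hb, h⟩)
      · exact .inr (.single ⟨hb, ha, h⟩)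
  obtain ⟨x, hx, hxz⟩ := Finset.exists_forall_rel_of_total (ReachIn D Q) (fun _ => .refl)
    (fun _ _ _ => Relation.ReflTransGen.trans) hne htotal
  obtain ⟨y, hy, hyz⟩ := Finset.exists_forall_rel_of_total (fun a b => ReachIn D Q b a)
    (fun _ => .refl) (fun _ _ _ h h' => Relation.ReflTransGen.trans h' h) hne
    fun a ha b hb => (htotal a ha b hb).symm
  by_cases hxy : x = y
  · subst hxy
    obtain ⟨z, hz, hzx⟩ := Finset.exists_mem_ne hcard x
    exact ⟨x, hx, z, hz, hzx.symm, Q, hQL, hQ, hx, hz,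
      fun w hw => ⟨hxz w hw, (hyz w hw).trans (hxz z hz)⟩⟩
  · exact ⟨x, hx, y, hy, hxy, Q, hQL, hQ, hx, hy, fun w hw => ⟨hxz w hw, hyz w hw⟩⟩

theorem ReachIn.subtype {V : Type*} {D : Digraph V} {Q : Finset V} {x y : V}
    (h : ReachIn D Q x y) (hx : x ∈ (Q : Set V)) (hy : y ∈ (Q : Set V)) :
    Relation.ReflTransGen (fun a b : (Q : Set V) => D.Adj a b) ⟨x, hx⟩ ⟨y, hy⟩ := by
  induction h with
  | refl => exact .refl
  | tail _ h ih => exact (ih h.1).tail h.2.2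

/-- Otherwise y → v, and v → x ⇝ z ⇝ y → v for every z in the clique makes the clique together with
v strongly connected. -/
theorem Forces.adj {V : Type*} [DecidableEq V] {G : SimpleGraph V} {D : Digraph V}
    (hD : IsOrientation G D) {k : ℕ}
    (hS : ∀ S : Finset V, G.IsNClique (k + 1) S → ¬ IsStronglyConnectedOn D (S : Set V))
    {L : Finset V} {v : V} (hL : ∀ u ∈ L, G.Adj v u) {x y : V} (h : Forces G D k L x y)
    (hvx : D.Adj v x) : D.Adj v y := by
  obtain ⟨Q, hQL, hQ, hx, hy, hz⟩ := h
  rcases (hD.1 v y).1 (hL y (hQL hy)) with h | hyv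
  · exact h
  exfalso
  refine hS _ (hQ.insert fun b hb => hL b (hQL hb)) ?_
  have hsub : Q ⊆ insert v Q := Finset.subset_insert v Q
  have hv : v ∈ insert v Q := Finset.mem_insert_self v Q
  have key : ∀ z ∈ insert v Q, ReachIn D (insert v Q) v z ∧ ReachIn D (insert v Q) z v := by
    intro z hzQ
    rcases Finset.mem_insert.1 hzQ with rfl | hzQ
    · exact ⟨.refl, .refl⟩
    · exact ⟨.head ⟨hv, hsub hx, hvx⟩ ((hz z hzQ).1.mono hsub fun _ _ _ _ => id),
        .tail ((hz z hzQ).2.mono hsub fun _ _ _ _ => id) ⟨hsub hy, hv, hyv⟩⟩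
  rintro ⟨a, ha⟩ ⟨b, hb⟩
  exact ReachIn.subtype ((key a ha).2.trans (key b hb).1) ha hb

/-- Take a generating set of least size: if one member generated another, the latter could be
erased. -/
theorem Finset.exists_antichain_generating {V : Type*} (R : V → V → Prop) (hrefl : ∀ a, R a a)
    (htrans : ∀ a b c, R a b → R b c → R a c) (A : Finset V) :
    ∃ S ⊆ A, (∀ a ∈ A, ∃ s ∈ S, R s a) ∧ ∀ s ∈ S, ∀ t ∈ S, R s t → s = t := by
  classical
  have hne : (A.powerset.filter fun S => ∀ a ∈ A, ∃ s ∈ S, R s a).Nonempty :=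
    ⟨A, by simpa using fun a ha => ⟨a, ha, hrefl a⟩⟩
  obtain ⟨S, hS, hmin⟩ := Finset.exists_min_image _ Finset.card hne
  simp only [Finset.mem_filter, Finset.mem_powerset] at hS hmin
  refine ⟨S, hS.1, hS.2, fun s hs t ht hst => ?_⟩
  by_contra hne
  have := hmin (S.erase t) ⟨(S.erase_subset t).trans hS.1, fun a ha => ?_⟩
  · have := Finset.card_erase_lt_of_mem ht
    omega
  · obtain ⟨u, hu, hua⟩ := hS.2 a ha
    by_cases hut : u = t
    · exact ⟨s, Finset.mem_erase.2 ⟨hne, hs⟩, htrans _ _ _ hst (hut ▸ hua)⟩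
    · exact ⟨u, Finset.mem_erase.2 ⟨hut, hu⟩, hua⟩

theorem Finset.card_filter_card_lt_le {V : Type*} [Fintype V] (hV : 2 ≤ Fintype.card V) (M : ℕ) :
    (Finset.univ.filter fun S : Finset V => S.card < M).card ≤ Fintype.card V ^ M := by
  classical
  have h : (Finset.univ.filter fun S : Finset V => S.card < M) =
      (Finset.range M).biUnion fun i => Finset.powersetCard i Finset.univ := by
    ext S; simp [Finset.mem_powersetCard]
  calc _ ≤ ∑ i ∈ Finset.range M, (Finset.powersetCard i (Finset.univ : Finset V)).card := by
        rw [h]; exact Finset.card_biUnion_le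
    _ ≤ ∑ i ∈ Finset.range M, Fintype.card V ^ i := Finset.sum_le_sum fun i _ => by
        rw [Finset.card_powersetCard, Finset.card_univ]; exact Nat.choose_le_pow _ _
    _ ≤ _ := (Nat.geomSum_lt hV fun i hi => Finset.mem_range.1 hi).le

/-- If every set of `M` vertices contains a `k`-clique, then an orientation without strongly
connected copies of `K_{k+1}` is determined by choosing fewer than `M` vertices for every vertex. -/
theorem numOrientations_le_pow {V : Type*} [Fintype V] [LinearOrder V]
    (hV : 2 ≤ Fintype.card V) (G : SimpleGraph V) {k M : ℕ} (hk : 2 ≤ k)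
    (hG : ∀ U : Finset V, U.card = M → ∃ Q ⊆ U, G.IsNClique k Q) :
    numOrientations (k + 1) G ≤ (Fintype.card V ^ M) ^ Fintype.card V := by
  classical
  set L : V → Finset V := fun v => Finset.univ.filter fun u => u < v ∧ G.Adj v u with hLdef
  have hL : ∀ v, ∀ u ∈ L v, G.Adj v u := fun v u hu => (Finset.mem_filter.1 hu).2.2
  have hLlt : ∀ v, ∀ u ∈ L v, u < v := fun v u hu => (Finset.mem_filter.1 hu).2.1
  have hcode : ∀ D : Digraph V, ∀ v, ∃ S ⊆ (L v).filter (D.Adj v),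
      (∀ a ∈ (L v).filter (D.Adj v), ∃ s ∈ S, Relation.ReflTransGen (Forces G D k (L v)) s a) ∧
      ∀ s ∈ S, ∀ t ∈ S, Relation.ReflTransGen (Forces G D k (L v)) s t → s = t := fun D v =>
    Finset.exists_antichain_generating _ (fun _ => .refl)
      (fun _ _ _ => Relation.ReflTransGen.trans) _
  choose code hsub hgen hanti using hcode
  unfold numOrientations
  rw [← Finset.card_univ (α := V), ← Finset.prod_const]
  refine le_trans ?_ (Finset.prod_le_prod' fun _ _ => Finset.card_filter_card_lt_le hV M)
  rw [← Fintype.card_piFinset, ← Set.ncard_coe_finset]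
  refine Set.ncard_le_ncard_of_injOn code ?_ ?_ (Finset.finite_toSet _)
  -- A code with at least M elements would contain a k-clique, hence a forcing pair of distinct
  -- elements, against the antichain property.
  · rintro D ⟨hD, -⟩
    simp only [Finset.mem_coe, Fintype.mem_piFinset, Finset.mem_filter, Finset.mem_univ, true_and]
    intro v
    by_contra! hM
    obtain ⟨U, hU, hUM⟩ := Finset.exists_subset_card_eq hM
    obtain ⟨Q, hQU, hQ⟩ := hG U hUM
    have hQS := hQU.trans hU
    obtain ⟨x, hx, y, hy, hxy, h⟩ := exists_forces_of_isNClique hD hk hQ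
      ((hQS.trans (hsub D v)).trans (Finset.filter_subset _ _))
    exact hxy (hanti D v x (hQS hx) y (hQS hy) (.single h))
  · rintro D ⟨hD, hDS⟩ D' ⟨hD', hDS'⟩ heq
    have hmem : ∀ D : Digraph V, IsOrientation G D →
        (∀ S : Finset V, G.IsNClique (k + 1) S → ¬ IsStronglyConnectedOn D (S : Set V)) →
        ∀ v u, u < v → (D.Adj v u ↔ u ∈ L v ∧
          ∃ s ∈ code D v, Relation.ReflTransGen (Forces G D k (L v)) s u) := by
      intro D hD hDS v u huv
      constructor
      · intro h
        have hu : u ∈ L v := Finset.mem_filter.2 ⟨Finset.mem_univ _, huv, (hD.1 v u).2 (.inl h)⟩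
        exact ⟨hu, hgen D v u (Finset.mem_filter.2 ⟨hu, h⟩)⟩
      · rintro ⟨-, s, hs, hsu⟩
        have hs := (Finset.mem_filter.1 (hsub D v hs)).2
        induction hsu with
        | refl => exact hs
        | tail _ h ih =>
          obtain ⟨Q, hQL, -, hx, -⟩ := id h
          exact h.adj hD hDS (hL v) (ih (hLlt v _ (hQL hx)))
    have hback : ∀ D : Digraph V, IsOrientation G D → ∀ u v,
        (D.Adj u v ↔ G.Adj u v ∧ ¬ D.Adj v u) := by
      intro D hD u v
      rw [hD.1 u v]
      have := hD.2 u v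
      tauto
    -- Decoding goes vertex by vertex: once all arcs between vertices below v are known, so is the
    -- forcing relation on `L v`, and the code at v then gives the arcs from v down.
    have key : ∀ v, ∀ u < v, (D.Adj v u ↔ D'.Adj v u) := by
      intro v
      induction v using WellFoundedLT.induction with
      | _ v ih =>
        intro u huv
        have hagree : ∀ a ∈ L v, ∀ b ∈ L v, (D.Adj a b ↔ D'.Adj a b) := by
          intro a ha b hb
          rcases lt_trichotomy a b with hab | hab | hab
          · rw [hback D hD, hback D' hD', ih b (hLlt v b hb) a hab]
          · subst hab
            exact ⟨fun h => (hD.2 _ _ h h).elim, fun h => (hD'.2 _ _ h h).elim⟩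
          · exact ih a (hLlt v a ha) b hab
        have hF : Forces G D k (L v) = Forces G D' k (L v) := by
          ext x y
          exact ⟨Forces.congr fun a ha b hb => (hagree a ha b hb).1,
            Forces.congr fun a ha b hb => (hagree a ha b hb).2⟩
        rw [hmem D hD hDS v u huv, hmem D' hD' hDS' v u huv, hF, heq]
    ext u v
    rcases lt_trichotomy u v with huv | huv | huv
    · rw [hback D hD, hback D' hD', key v u huv]
    · subst huv
      exact ⟨fun h => (hD.2 _ _ h h).elim, fun h => (hD'.2 _ _ h h).elim⟩
    · exact key u v huv

/-! ### Binomial random subsets and Janson's inequality. -/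

/-- The expectation of `f S` for a random subset `S` of `E` containing every element of `E`
independently with probability `p`. -/
noncomputable def binomExp {α : Type*} (E : Finset α) (p : ℝ) (f : Finset α → ℝ) : ℝ :=
  ∑ S ∈ E.powerset, p ^ S.card * (1 - p) ^ (E.card - S.card) * f S

theorem binomExp_mono {α : Type*} {E : Finset α} {p : ℝ} (hp0 : 0 ≤ p) (hp1 : p ≤ 1)
    {f g : Finset α → ℝ} (h : ∀ S, f S ≤ g S) : binomExp E p f ≤ binomExp E p g :=
  Finset.sum_le_sum fun S _ => mul_le_mul_of_nonneg_left (h S)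
    (mul_nonneg (pow_nonneg hp0 _) (pow_nonneg (sub_nonneg.2 hp1) _))

theorem binomExp_one {α : Type*} (E : Finset α) (p : ℝ) : binomExp E p (fun _ => 1) = 1 := by
  simp [binomExp, Finset.sum_pow_mul_eq_add_pow]

theorem binomExp_const_mul {α : Type*} (E : Finset α) (p c : ℝ) (f : Finset α → ℝ) :
    binomExp E p (fun S => c * f S) = c * binomExp E p f := by
  simp only [binomExp, Finset.mul_sum]
  exact Finset.sum_congr rfl fun S _ => by ring

theorem binomExp_sub {α : Type*} (E : Finset α) (p : ℝ) (f g : Finset α → ℝ) :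
    binomExp E p (fun S => f S - g S) = binomExp E p f - binomExp E p g := by
  simp only [binomExp, mul_sub, Finset.sum_sub_distrib]

theorem binomExp_sum {α ι : Type*} (E : Finset α) (p : ℝ) (I : Finset ι)
    (f : ι → Finset α → ℝ) :
    binomExp E p (fun S => ∑ i ∈ I, f i S) = ∑ i ∈ I, binomExp E p (f i) := by
  simp only [binomExp, Finset.mul_sum]
  exact Finset.sum_comm

theorem binomExp_mem {α : Type*} [DecidableEq α] {E : Finset α} (p : ℝ) {e : α} (he : e ∈ E)
    (f : Finset α → ℝ) :
    binomExp E p (fun S => if e ∈ S then f S else 0) = p * binomExp E p (fun S => f (insert e S)) := by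
  obtain ⟨F, heF, rfl⟩ : ∃ F, e ∉ F ∧ insert e F = E :=
    ⟨E.erase e, Finset.notMem_erase e E, Finset.insert_erase he⟩
  simp only [binomExp, Finset.sum_powerset_insert heF, Finset.mul_sum, ← Finset.sum_add_distrib]
  refine Finset.sum_congr rfl fun S hS => ?_
  have hS := Finset.mem_powerset.1 hS
  have heS : e ∉ S := fun h => heF (hS h)
  have hcard := Finset.card_le_card hS
  rw [Finset.card_insert_of_notMem heS, Finset.card_insert_of_notMem heF, Nat.add_sub_add_right,
    show F.card + 1 - S.card = F.card - S.card + 1 by omega]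
  simp only [heS, Finset.mem_insert_self, if_true, if_false, Finset.insert_idem]
  ring

/-- Conditioning on `A ⊆ S` amounts to adding `A` to the random set. -/
theorem binomExp_subset {α : Type*} [DecidableEq α] {E : Finset α} (p : ℝ) {A : Finset α}
    (hA : A ⊆ E) (f : Finset α → ℝ) :
    binomExp E p (fun S => if A ⊆ S then f S else 0) =
      p ^ A.card * binomExp E p (fun S => f (S ∪ A)) := by
  induction A using Finset.induction_on generalizing f with
  | empty => simp
  | insert e A heA ih =>
    have h1 : (fun S : Finset α => if insert e A ⊆ S then f S else 0) =
        fun S => if e ∈ S then (if A ⊆ S then f S else 0) else 0 := by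
      ext S
      simp only [Finset.insert_subset_iff, ite_and]
    have h2 : (fun S : Finset α => if A ⊆ insert e S then f (insert e S) else 0) =
        fun S => if A ⊆ S then f (insert e S) else 0 := by
      ext S
      simp only [Finset.subset_insert_iff_of_notMem heA]
    rw [h1, binomExp_mem p (hA (Finset.mem_insert_self e A)), h2,
      ih ((Finset.subset_insert e A).trans hA), Finset.card_insert_of_notMem heA, pow_succ,
      ← mul_assoc, mul_comm p]
    simp only [Finset.union_insert]

theorem Finset.one_sub_sum_le_prod_one_sub {ι : Type*} (J : Finset ι) {f : ι → ℝ}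
    (h0 : ∀ j ∈ J, 0 ≤ f j) (h1 : ∀ j ∈ J, f j ≤ 1) : 1 - ∑ j ∈ J, f j ≤ ∏ j ∈ J, (1 - f j) := by
  classical
  induction J using Finset.induction_on with
  | empty => simp
  | insert a J ha ih =>
    have h0a := h0 a (Finset.mem_insert_self a J)
    have h1a := h1 a (Finset.mem_insert_self a J)
    have h0J : ∀ j ∈ J, 0 ≤ f j := fun j hj => h0 j (Finset.mem_insert_of_mem hj)
    have ih := ih h0J fun j hj => h1 j (Finset.mem_insert_of_mem hj)
    have hsum := mul_nonneg h0a (Finset.sum_nonneg h0J)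
    rw [Finset.sum_insert ha, Finset.prod_insert ha]
    nlinarith [mul_le_mul_of_nonneg_left ih (sub_nonneg.2 h1a)]

/-- Janson's inequality, with a damping parameter `q`. -/
theorem binomExp_prod_le_exp {α ι : Type*} [DecidableEq α] [DecidableEq ι] {E : Finset α} {p q : ℝ}
    (hp0 : 0 ≤ p) (hp1 : p ≤ 1) (hq0 : 0 ≤ q) (hq1 : q ≤ 1) (A : ι → Finset α) (I : Finset ι)
    (hA : ∀ i ∈ I, A i ⊆ E) :
    binomExp E p (fun S => ∏ i ∈ I, (1 - q * if A i ⊆ S then 1 else 0)) ≤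
      Real.exp (-q * ∑ i ∈ I, p ^ (A i).card + q ^ 2 * ∑ i ∈ I,
        ∑ j ∈ I.filter (fun j => j ≠ i ∧ ¬ Disjoint (A i) (A j)), p ^ (A i ∪ A j).card) := by
  induction I using Finset.induction_on with
  | empty => simp [binomExp_one]
  | insert a I haI ih =>
    have ih := ih fun i hi => hA i (Finset.mem_insert_of_mem hi)
    have hAa : A a ⊆ E := hA a (Finset.mem_insert_self a I)
    set x : ι → Finset α → ℝ := fun i S => 1 - q * if A i ⊆ S then 1 else 0 with hx
    have hx0 : ∀ i S, 0 ≤ x i S := fun i S => by simp only [hx]; split_ifs <;> linarith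
    have hx1 : ∀ i S, x i S ≤ 1 := fun i S => by simp only [hx]; split_ifs <;> linarith
    have hxanti : ∀ i S T, S ⊆ T → x i T ≤ x i S := fun i S T hST => by
      simp only [hx]
      have : A i ⊆ S → A i ⊆ T := fun h => h.trans hST
      split_ifs <;> first | linarith | tauto
    -- `J` collects the events that depend on `A a`. The product `g` over the others is unaffected
    -- by adding `A a` to the random set, and it decreases in that set; this monotonicity replaces a
    -- correlation inequality.
    set J := I.filter fun j => j ≠ a ∧ ¬ Disjoint (A a) (A j) with hJ
    set N := I \ J with hN
    have hJI : J ⊆ I := Finset.filter_subset _ _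
    set g : Finset α → ℝ := fun S => ∏ i ∈ N, x i S with hg
    have hg0 : ∀ S, 0 ≤ g S := fun S => Finset.prod_nonneg fun i _ => hx0 i S
    have hganti : ∀ S T, S ⊆ T → g T ≤ g S := fun S T hST =>
      Finset.prod_le_prod (fun i _ => hx0 i T) fun i _ => hxanti i S T hST
    have hgA : ∀ S, g (S ∪ A a) = g S := fun S => by
      refine Finset.prod_congr rfl fun i hi => ?_
      have hd : Disjoint (A a) (A i) := by
        by_contra hd
        have hi' := Finset.mem_sdiff.1 hi
        exact hi'.2 (Finset.mem_filter.2 ⟨hi'.1, fun h => haI (h ▸ hi'.1), hd⟩)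
      have : A i ⊆ S ∪ A a ↔ A i ⊆ S :=
        ⟨fun h => hd.symm.left_le_of_le_sup_right h, fun h => h.trans Finset.subset_union_left⟩
      simp only [hx, this]
    have hfac : ∀ S, ∏ i ∈ I, x i S = (∏ i ∈ J, x i S) * g S := fun S => by
      rw [mul_comm, hg, hN, Finset.prod_sdiff hJI]
    have hbern : ∀ S, 1 - q * ∑ j ∈ J, (if A j ⊆ S then (1 : ℝ) else 0) ≤ ∏ i ∈ J, x i S := by
      intro S
      rw [Finset.mul_sum]
      exact Finset.one_sub_sum_le_prod_one_sub J
        (fun j _ => by split_ifs <;> linarith) fun j _ => by split_ifs <;> linarith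
    set F := binomExp E p (fun S => ∏ i ∈ I, x i S) with hF
    have hFg : F ≤ binomExp E p g := binomExp_mono hp0 hp1 fun S => by
      rw [hfac]
      exact mul_le_of_le_one_left (hg0 S) (Finset.prod_le_one (fun i _ => hx0 i S) fun i _ => hx1 i S)
    have hF0 : 0 ≤ F := Finset.sum_nonneg fun S _ => mul_nonneg
      (mul_nonneg (pow_nonneg hp0 _) (pow_nonneg (sub_nonneg.2 hp1) _))
      (Finset.prod_nonneg fun i _ => hx0 i S)
    set δ := ∑ j ∈ J, p ^ (A a ∪ A j).card with hδ
    have hδ0 : 0 ≤ δ := Finset.sum_nonneg fun j _ => pow_nonneg hp0 _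
    have hstep : binomExp E p (fun S => ∏ i ∈ insert a I, x i S) =
        F - q * binomExp E p (fun S => if A a ⊆ S then ∏ i ∈ I, x i S else 0) := by
      rw [← binomExp_const_mul, hF, ← binomExp_sub]
      congr 1
      ext S
      rw [Finset.prod_insert haI]
      simp only [hx]
      split_ifs <;> ring
    have hlow : (p ^ (A a).card - q * δ) * binomExp E p g ≤
        binomExp E p (fun S => if A a ⊆ S then ∏ i ∈ I, x i S else 0) := by
      calc (p ^ (A a).card - q * δ) * binomExp E p g
          = p ^ (A a).card * binomExp E p g -
              q * ∑ j ∈ J, p ^ (A a ∪ A j).card * binomExp E p g := by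
            rw [← Finset.sum_mul, hδ]; ring
        _ ≤ p ^ (A a).card * binomExp E p (fun S => g (S ∪ A a)) -
              q * ∑ j ∈ J, p ^ (A a ∪ A j).card * binomExp E p (fun S => g (S ∪ (A a ∪ A j))) := by
            simp only [hgA]
            refine sub_le_sub_left (mul_le_mul_of_nonneg_left ?_ hq0) _
            exact Finset.sum_le_sum fun j _ => mul_le_mul_of_nonneg_left
              (binomExp_mono hp0 hp1 fun S => hganti _ _ Finset.subset_union_left) (pow_nonneg hp0 _)
        _ = binomExp E p (fun S => if A a ⊆ S then g S else 0) -
              q * ∑ j ∈ J, binomExp E p (fun S => if A a ∪ A j ⊆ S then g S else 0) := by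
            rw [binomExp_subset p hAa]
            congr 2
            refine Finset.sum_congr rfl fun j hj => ?_
            rw [binomExp_subset p (Finset.union_subset hAa
              (hA j (Finset.mem_insert_of_mem (hJI hj))))]
        _ = binomExp E p (fun S => (if A a ⊆ S then g S else 0) -
              q * ∑ j ∈ J, if A a ∪ A j ⊆ S then g S else 0) := by
            rw [binomExp_sub, binomExp_const_mul, binomExp_sum]
        _ ≤ _ := by
            refine binomExp_mono hp0 hp1 fun S => ?_
            by_cases hS : A a ⊆ S
            · simp only [hS, if_true, Finset.union_subset_iff, true_and]
              rw [hfac]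
              refine le_trans (le_of_eq ?_) (mul_le_mul_of_nonneg_right (hbern S) (hg0 S))
              rw [sub_mul, one_mul, mul_assoc, Finset.sum_mul]
              simp only [ite_mul, one_mul, zero_mul]
            · simp [hS, Finset.union_subset_iff]
    have hmul : binomExp E p (fun S => ∏ i ∈ insert a I, x i S) ≤
        F * Real.exp (-q * p ^ (A a).card + q ^ 2 * δ) := by
      have hexp := Real.add_one_le_exp (-q * p ^ (A a).card + q ^ 2 * δ)
      by_cases hneg : 0 ≤ p ^ (A a).card - q * δ
      · have h1 := hlow
        have h2 : (p ^ (A a).card - q * δ) * F ≤ (p ^ (A a).card - q * δ) * binomExp E p g :=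
          mul_le_mul_of_nonneg_left hFg hneg
        rw [hstep]
        calc _ ≤ F - q * ((p ^ (A a).card - q * δ) * F) :=
              sub_le_sub_left (mul_le_mul_of_nonneg_left (h2.trans h1) hq0) _
          _ = F * (-q * p ^ (A a).card + q ^ 2 * δ + 1) := by ring
          _ ≤ _ := mul_le_mul_of_nonneg_left hexp hF0
      -- Here the exponent is nonnegative, so dropping the new factor is enough.
      · calc binomExp E p (fun S => ∏ i ∈ insert a I, x i S) ≤ F := binomExp_mono hp0 hp1 fun S => by
              rw [Finset.prod_insert haI]
              exact mul_le_of_le_one_left (Finset.prod_nonneg fun i _ => hx0 i S) (hx1 a S)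
          _ ≤ _ := le_mul_of_one_le_right hF0 (Real.one_le_exp (by nlinarith))
    refine hmul.trans ((mul_le_mul_of_nonneg_right ih (Real.exp_pos _).le).trans ?_)
    rw [← Real.exp_add, Finset.sum_insert haI, Finset.sum_insert haI]
    refine Real.exp_le_exp.2 ?_
    have hJ' : δ ≤ ∑ j ∈ (insert a I).filter (fun j => j ≠ a ∧ ¬ Disjoint (A a) (A j)),
        p ^ (A a ∪ A j).card :=
      Finset.sum_le_sum_of_subset_of_nonneg
        (Finset.filter_subset_filter _ (Finset.subset_insert a I)) fun _ _ _ => pow_nonneg hp0 _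
    have hI' : ∑ i ∈ I, ∑ j ∈ I.filter (fun j => j ≠ i ∧ ¬ Disjoint (A i) (A j)),
          p ^ (A i ∪ A j).card ≤
        ∑ i ∈ I, ∑ j ∈ (insert a I).filter (fun j => j ≠ i ∧ ¬ Disjoint (A i) (A j)),
          p ^ (A i ∪ A j).card :=
      Finset.sum_le_sum fun i _ => Finset.sum_le_sum_of_subset_of_nonneg
        (Finset.filter_subset_filter _ (Finset.subset_insert a I)) fun _ _ _ => pow_nonneg hp0 _
    have := mul_le_mul_of_nonneg_left (add_le_add hJ' hI') (sq_nonneg q)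
    linarith

/-! ### Cliques in the random graph. -/

/-- The edges of the complete graph on `Q`. -/
def cliqueEdges {V : Type*} [DecidableEq V] (Q : Finset V) : Finset (Sym2 V) :=
  Q.offDiag.image Sym2.mk.uncurry

theorem mk_mem_cliqueEdges {V : Type*} [DecidableEq V] {Q : Finset V} {a b : V} :
    s(a, b) ∈ cliqueEdges Q ↔ a ∈ Q ∧ b ∈ Q ∧ a ≠ b := by
  simp only [cliqueEdges, Finset.mem_image, Finset.mem_offDiag, Prod.exists,
    Function.uncurry_apply_pair, Sym2.eq_iff]
  constructor
  · rintro ⟨x, y, ⟨hx, hy, hxy⟩, ⟨rfl, rfl⟩ | ⟨rfl, rfl⟩⟩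
    · exact ⟨hx, hy, hxy⟩
    · exact ⟨hy, hx, hxy.symm⟩
  · rintro h
    exact ⟨a, b, h, .inl ⟨rfl, rfl⟩⟩

theorem card_cliqueEdges {V : Type*} [DecidableEq V] (Q : Finset V) :
    (cliqueEdges Q).card = Q.card.choose 2 :=
  Sym2.card_image_offDiag Q

theorem cliqueEdges_inter {V : Type*} [DecidableEq V] (Q R : Finset V) :
    cliqueEdges Q ∩ cliqueEdges R = cliqueEdges (Q ∩ R) := by
  ext e
  induction e with
  | _ a b =>
    simp only [Finset.mem_inter, mk_mem_cliqueEdges]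
    tauto

theorem cliqueEdges_mono {V : Type*} [DecidableEq V] {Q R : Finset V} (h : Q ⊆ R) :
    cliqueEdges Q ⊆ cliqueEdges R :=
  Finset.image_subset_image (Finset.offDiag_mono h)

theorem coe_cliqueEdges_subset_edgeSet {V : Type*} [DecidableEq V] {G : SimpleGraph V}
    {Q : Finset V} : (cliqueEdges Q : Set (Sym2 V)) ⊆ G.edgeSet ↔ G.IsClique Q := by
  constructor
  · intro h a ha b hb hab
    simpa using h (Finset.mem_coe.2 (mk_mem_cliqueEdges.2 ⟨ha, hb, hab⟩))
  · intro h e he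
    induction e with
    | _ a b =>
      obtain ⟨ha, hb, hab⟩ := mk_mem_cliqueEdges.1 (Finset.mem_coe.1 he)
      simpa using h ha hb hab

theorem edgeFinset_subset_cliqueEdges_univ {V : Type*} [Fintype V] [DecidableEq V]
    {G : SimpleGraph V} [Fintype G.edgeSet] : G.edgeFinset ⊆ cliqueEdges Finset.univ := by
  intro e he
  induction e with
  | _ a b => exact mk_mem_cliqueEdges.2 ⟨by simp, by simp, SimpleGraph.Adj.ne (by simpa using he)⟩

theorem binomialRandom_real_le_binomExp {V : Type*} [Fintype V] [DecidableEq V]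
    (p : unitInterval) (s : Set (SimpleGraph V)) {f : Finset (Sym2 V) → ℝ} (hf0 : ∀ S, 0 ≤ f S)
    (hf : ∀ G ∈ s, ∀ S : Finset (Sym2 V), (S : Set (Sym2 V)) = G.edgeSet → 1 ≤ f S) :
    G(V, p).real s ≤ binomExp (cliqueEdges (Finset.univ : Finset V)) p f := by
  classical
  have hp0 := p.2.1
  have hp1 : 0 ≤ 1 - (p : ℝ) := sub_nonneg.2 p.2.2
  have hs : s = ⋃ G ∈ Finset.univ.filter (· ∈ s), {G} := by ext; simp
  have hG : ∀ G : SimpleGraph V, G(V, p).real {G} = (p : ℝ) ^ G.edgeFinset.card *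
      (1 - p) ^ ((cliqueEdges (Finset.univ : Finset V)).card - G.edgeFinset.card) := by
    intro G
    rw [MeasureTheory.measureReal_def, SimpleGraph.binomialRandom_singleton, card_cliqueEdges,
      Finset.card_univ, Nat.card_eq_fintype_card, ← SimpleGraph.coe_edgeFinset,
      Set.ncard_coe_finset]
    simp
  calc G(V, p).real s
      ≤ ∑ G ∈ Finset.univ.filter (· ∈ s), G(V, p).real {G} := by
        conv_lhs => rw [hs]
        exact MeasureTheory.measureReal_biUnion_finset_le _ _
    _ ≤ ∑ G ∈ Finset.univ.filter (· ∈ s), (p : ℝ) ^ G.edgeFinset.card *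
          (1 - p) ^ ((cliqueEdges (Finset.univ : Finset V)).card - G.edgeFinset.card) *
          f G.edgeFinset := Finset.sum_le_sum fun G hGs => by
        rw [hG]
        exact le_mul_of_one_le_right (by positivity) 
          (hf G (Finset.mem_filter.1 hGs).2 _ G.coe_edgeFinset)
    _ = ∑ S ∈ (Finset.univ.filter (· ∈ s)).image fun G : SimpleGraph V => G.edgeFinset,
          (p : ℝ) ^ S.card * (1 - p) ^ ((cliqueEdges (Finset.univ : Finset V)).card - S.card) *
          f S := by
        rw [Finset.sum_image fun G _ H _ h => SimpleGraph.edgeFinset_inj.1 h]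
    _ ≤ _ := by
        refine Finset.sum_le_sum_of_subset_of_nonneg ?_ fun S _ _ => ?_
        · intro S hS
          obtain ⟨G, -, rfl⟩ := Finset.mem_image.1 hS
          exact Finset.mem_powerset.2 edgeFinset_subset_cliqueEdges_univ
        · have := hf0 S
          positivity

theorem pow_card_cliqueEdges_union {V : Type*} [DecidableEq V] {p : ℝ} (hp : 0 < p) {k : ℕ}
    {Q R : Finset V} (hQ : Q.card = k) (hR : R.card = k) :
    p ^ (cliqueEdges Q ∪ cliqueEdges R).card =
      (p ^ k.choose 2) ^ 2 / p ^ (Q ∩ R).card.choose 2 := by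
  rw [eq_div_iff (pow_pos hp _).ne', ← card_cliqueEdges (Q ∩ R), ← cliqueEdges_inter, ← pow_add,
    Finset.card_union_add_card_inter, card_cliqueEdges, card_cliqueEdges, hQ, hR, ← pow_mul]
  congr 1
  ring

/-- Group R by T = Q ∩ R, with at most 2^k choices. Sharing an edge means t = |T| ≥ 2, and at most
|U|^(k-t) sets R give the same T, so each group costs a factor |U|^t p^(t choose 2) ≥ Φ in the
denominator. -/
theorem sum_pow_card_cliqueEdges_union_le {V : Type*} [DecidableEq V] {p Φ : ℝ} (hp : 0 < p)
    (hΦ0 : 0 < Φ) {k : ℕ} {U Q : Finset V}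
    (hΦ : ∀ j, 2 ≤ j → j ≤ k → Φ ≤ (U.card : ℝ) ^ j * p ^ j.choose 2) (hQ : Q.card = k) :
    ∑ R ∈ (Finset.powersetCard k U).filter
        (fun R => R ≠ Q ∧ ¬ Disjoint (cliqueEdges Q) (cliqueEdges R)),
        p ^ (cliqueEdges Q ∪ cliqueEdges R).card ≤
      2 ^ k * (p ^ k.choose 2 * ((U.card : ℝ) ^ k * p ^ k.choose 2) / Φ) := by
  set F := (Finset.powersetCard k U).filter
    (fun R => R ≠ Q ∧ ¬ Disjoint (cliqueEdges Q) (cliqueEdges R)) with hF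
  rw [← Finset.sum_fiberwise_of_maps_to (t := Q.powerset) (g := fun R => Q ∩ R)
    fun R _ => Finset.mem_powerset.2 Finset.inter_subset_left]
  have hcard : (Q.powerset.card : ℝ) = 2 ^ k := by rw [Finset.card_powerset, hQ]; norm_cast
  rw [← hcard, ← nsmul_eq_mul]
  refine Finset.sum_le_card_nsmul _ _ _ fun T hT => ?_
  have hTQ := Finset.mem_powerset.1 hT
  have hTk : T.card ≤ k := hQ ▸ Finset.card_le_card hTQ
  have hmem : ∀ R ∈ F.filter (fun R => Q ∩ R = T),
      R ⊆ U ∧ R.card = k ∧ ¬ Disjoint (cliqueEdges Q) (cliqueEdges R) ∧ Q ∩ R = T := by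
    intro R hR
    simp only [hF, Finset.mem_filter, Finset.mem_powersetCard] at hR
    tauto
  have hnum : (F.filter fun R => Q ∩ R = T).card ≤ U.card ^ (k - T.card) := by
    refine le_trans ?_ (Nat.choose_le_pow _ _)
    rw [← Finset.card_powersetCard]
    refine Finset.card_le_card_of_injOn (fun R => R \ Q) ?_ ?_
    · intro R hR
      obtain ⟨hRU, hRk, -, hRT⟩ := hmem R hR
      refine Finset.mem_powersetCard.2 ⟨Finset.sdiff_subset.trans hRU, ?_⟩
      rw [Finset.card_sdiff, hRT, hRk]
    · intro R hR R' hR' h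
      obtain ⟨-, -, -, hRT⟩ := hmem R hR
      obtain ⟨-, -, -, hRT'⟩ := hmem R' hR'
      simp only at h
      rw [← Finset.sdiff_union_inter R Q, ← Finset.sdiff_union_inter R' Q, h, Finset.inter_comm R,
        Finset.inter_comm R', hRT, hRT']
  rcases (F.filter fun R => Q ∩ R = T).eq_empty_or_nonempty with h | ⟨R₀, hR₀⟩
  · rw [h, Finset.sum_empty]
    positivity
  have hT2 : 2 ≤ T.card := by
    obtain ⟨-, -, hd, hRT⟩ := hmem R₀ hR₀
    obtain ⟨e, he, he'⟩ := Finset.not_disjoint_iff.1 hd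
    have : 0 < (cliqueEdges T).card := Finset.card_pos.2
      ⟨e, by rw [← hRT, ← cliqueEdges_inter]; exact Finset.mem_inter.2 ⟨he, he'⟩⟩
    rw [card_cliqueEdges] at this
    by_contra! hlt
    rw [Nat.choose_eq_zero_of_lt hlt] at this
    exact lt_irrefl _ this
  have hU : 0 < (U.card : ℝ) := by
    obtain ⟨hRU, -, -, hRT⟩ := hmem R₀ hR₀
    have := Finset.card_le_card ((hRT ▸ Finset.inter_subset_right : T ⊆ R₀).trans hRU)
    exact_mod_cast (by omega : 0 < U.card)
  calc ∑ R ∈ F.filter (fun R => Q ∩ R = T), p ^ (cliqueEdges Q ∪ cliqueEdges R).card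
      = ∑ R ∈ F.filter (fun R => Q ∩ R = T), (p ^ k.choose 2) ^ 2 / p ^ T.card.choose 2 :=
        Finset.sum_congr rfl fun R hR => by
          obtain ⟨-, hRk, -, hRT⟩ := hmem R hR
          rw [pow_card_cliqueEdges_union hp hQ hRk, hRT]
    _ ≤ (U.card : ℝ) ^ (k - T.card) * ((p ^ k.choose 2) ^ 2 / p ^ T.card.choose 2) := by
        rw [Finset.sum_const, nsmul_eq_mul]
        exact mul_le_mul_of_nonneg_right (mod_cast hnum) (by positivity)
    _ = p ^ k.choose 2 * ((U.card : ℝ) ^ k * p ^ k.choose 2) /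
          ((U.card : ℝ) ^ T.card * p ^ T.card.choose 2) := by
        rw [← pow_sub_mul_pow (U.card : ℝ) hTk]
        field_simp
    _ ≤ _ := div_le_div_of_nonneg_left (by positivity) hΦ0 (hΦ _ hT2 hTk)

theorem pow_le_mul_choose {k M : ℕ} (hk : 1 ≤ k) (hM : k ≤ M) :
    (M : ℝ) ^ k ≤ (k : ℝ) ^ k * k.factorial * M.choose k := by
  have h := Nat.pow_le_choose (α := ℝ) k M
  rw [div_le_iff₀ (by positivity)] at h
  have h2 : M ≤ k * (M + 1 - k) := by
    obtain ⟨a, rfl⟩ := Nat.exists_eq_add_of_le hM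
    rw [show k + a + 1 - k = a + 1 by omega]
    nlinarith
  calc (M : ℝ) ^ k ≤ ((k * (M + 1 - k) : ℕ) : ℝ) ^ k := by gcongr
    _ = (k : ℝ) ^ k * ((M + 1 - k : ℕ) : ℝ) ^ k := by push_cast; rw [mul_pow]
    _ ≤ (k : ℝ) ^ k * (M.choose k * k.factorial) := by gcongr
    _ = _ := by ring

/-- The probability that the random graph has no `k`-clique inside `U` is exponentially small in
the least expected number of labelled copies of a `K_j` with `2 ≤ j ≤ k`. -/
theorem binomExp_no_clique_le {V : Type*} [DecidableEq V] {p Φ : ℝ} (hp : 0 < p) (hp1 : p ≤ 1)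
    (hΦ0 : 0 < Φ) {k : ℕ} (hk : 2 ≤ k) {U : Finset V} (hU : k ≤ U.card)
    (hΦ : ∀ j, 2 ≤ j → j ≤ k → Φ ≤ (U.card : ℝ) ^ j * p ^ j.choose 2) {E : Finset (Sym2 V)}
    (hE : cliqueEdges U ⊆ E) :
    binomExp E p (fun S => if ∃ Q ∈ Finset.powersetCard k U, cliqueEdges Q ⊆ S then 0 else 1) ≤
      Real.exp (-(Φ / (2 ^ (k + 2) * (k ^ k * k.factorial)))) := by
  set π := p ^ k.choose 2 with hπ
  have hπ0 : 0 < π := pow_pos hp _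
  set Ψ := (U.card : ℝ) ^ k * π with hΨ
  have hΦΨ : Φ ≤ Ψ := hΦ k hk le_rfl
  have hΨ0 : 0 < Ψ := hΦ0.trans_le hΦΨ
  -- With μ the expected number of k-cliques in U, this q minimises -qμ + q²μ · 2^k Ψ/Φ.
  set q := Φ / (2 ^ (k + 1) * Ψ) with hq
  have hq0 : 0 ≤ q := by positivity
  have hq1 : q ≤ 1 := by
    rw [hq, div_le_one (by positivity)]
    have : (1 : ℝ) ≤ 2 ^ (k + 1) := one_le_pow₀ one_le_two
    nlinarith
  set I := Finset.powersetCard k U with hI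
  have hIcard : ∀ Q ∈ I, Q.card = k := fun Q hQ => (Finset.mem_powersetCard.1 hQ).2
  have hjanson := binomExp_prod_le_exp (E := E) hp.le hp1 hq0 hq1 cliqueEdges I
    fun Q hQ => (cliqueEdges_mono (Finset.mem_powersetCard.1 hQ).1).trans hE
  refine (binomExp_mono hp.le hp1 fun S => ?_).trans (hjanson.trans (Real.exp_le_exp.2 ?_))
  · have h0 : ∀ Q : Finset V, 0 ≤ 1 - q * if cliqueEdges Q ⊆ S then (1 : ℝ) else 0 := fun Q => by
      split_ifs <;> linarith
    split_ifs with h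
    · exact Finset.prod_nonneg fun Q _ => h0 Q
    · push Not at h
      rw [Finset.prod_eq_one fun Q hQ => by rw [if_neg (h Q hQ)]; ring]
  · have h1 : ∑ Q ∈ I, p ^ (cliqueEdges Q).card = I.card * π := by
      rw [← nsmul_eq_mul, ← Finset.sum_const]
      exact Finset.sum_congr rfl fun Q hQ => by rw [card_cliqueEdges, hIcard Q hQ]
    have h2 := Finset.sum_le_card_nsmul I _ _ fun Q hQ =>
      sum_pow_card_cliqueEdges_union_le hp hΦ0 hΦ (hIcard Q hQ)
    rw [nsmul_eq_mul] at h2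
    have h3 : Ψ ≤ k ^ k * k.factorial * I.card * π := by
      rw [hI, Finset.card_powersetCard]
      exact mul_le_mul_of_nonneg_right (pow_le_mul_choose (by omega) hU) hπ0.le
    have h4 : -q * (I.card * π) + q ^ 2 * (I.card * (2 ^ k * (π * Ψ / Φ))) =
        -(Φ * (I.card * π) / (2 ^ (k + 2) * Ψ)) := by
      rw [hq]
      field_simp
      ring
    rw [h1]
    refine (add_le_add_right (mul_le_mul_of_nonneg_left h2 (sq_nonneg q)) _).trans ?_
    rw [h4, neg_le_neg_iff, div_le_div_iff₀ (by positivity) (by positivity)]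
    calc Φ * (2 ^ (k + 2) * Ψ) ≤ Φ * (2 ^ (k + 2) * (k ^ k * k.factorial * I.card * π)) := by gcongr
      _ = _ := by ring

/-- The ratios m p^i of consecutive terms decrease in i, so the sequence rises and then falls, and
its minimum is at an endpoint. -/
theorem le_pow_mul_pow_choose {p Φ m : ℝ} (hp : 0 < p) (hm : 0 < m) {k : ℕ}
    (h2 : Φ ≤ m ^ 2 * p) (hk : Φ ≤ m ^ k * p ^ k.choose 2) (hp1 : p ≤ 1) {j : ℕ} (hj2 : 2 ≤ j)
    (hjk : j ≤ k) : Φ ≤ m ^ j * p ^ j.choose 2 := by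
  have hstep : ∀ i, m ^ (i + 1) * p ^ (i + 1).choose 2 = m ^ i * p ^ i.choose 2 * (m * p ^ i) := by
    intro i
    rw [Nat.choose_succ_succ' i 1, Nat.choose_one_right]
    ring
  by_cases h : 1 ≤ m * p ^ (j - 1)
  · have : ∀ i, 2 ≤ i → i ≤ j → Φ ≤ m ^ i * p ^ i.choose 2 := by
      intro i hi
      induction i, hi using Nat.le_induction with
      | base => intro _; simpa using h2
      | succ i hi ih =>
        intro hij
        rw [hstep]
        refine (ih (by omega)).trans (le_mul_of_one_le_right (by positivity) (h.trans ?_))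
        exact mul_le_mul_of_nonneg_left (pow_le_pow_of_le_one hp.le hp1 (by omega)) hm.le
    exact this j hj2 le_rfl
  · have : ∀ i, j ≤ i → m ^ i * p ^ i.choose 2 ≤ m ^ j * p ^ j.choose 2 := by
      intro i hi
      induction i, hi using Nat.le_induction with
      | base => exact le_rfl
      | succ i hi ih =>
        rw [hstep]
        refine (mul_le_of_le_one_right (by positivity) ?_).trans ih
        exact (mul_le_mul_of_nonneg_left
          (pow_le_pow_of_le_one hp.le hp1 (by omega)) hm.le).trans (not_le.1 h).le
    exact hk.trans (this k hjk)

/-! ### Union bound and choice of M. -/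

/-- The factor by which the expected number of cliques in a set of `M` vertices has to exceed
`M * log n` for a union bound over all such sets. -/
noncomputable def cliqueFactor (k : ℕ) : ℝ := 2 ^ (k + 3) * (k ^ k * k.factorial)

theorem binomialRandom_real_exists_cliqueFree_le {n k M : ℕ} (hn : 1 < n) (hk : 2 ≤ k) (hM : k ≤ M)
    (p : unitInterval) (hp : 0 < (p : ℝ)) (h2 : cliqueFactor k * Real.log n ≤ M * p)
    (hk' : cliqueFactor k * Real.log n * M ≤ (M : ℝ) ^ k * (p : ℝ) ^ k.choose 2) :
    G(Fin n, p).real {G | ∃ U : Finset (Fin n), U.card = M ∧ ∀ Q ⊆ U, ¬ G.IsNClique k Q} ≤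
      Real.exp (-Real.log n) := by
  classical
  have hlog : 0 < Real.log n := Real.log_pos (mod_cast hn)
  have hM0 : 0 < (M : ℝ) := by exact_mod_cast (by omega : 0 < M)
  have hK : 0 < cliqueFactor k := by unfold cliqueFactor; positivity
  set E := cliqueEdges (Finset.univ : Finset (Fin n)) with hE
  set f : Finset (Fin n) → Finset (Sym2 (Fin n)) → ℝ := fun U S =>
    if ∃ Q ∈ Finset.powersetCard k U, cliqueEdges Q ⊆ S then 0 else 1 with hf
  have hf0 : ∀ U S, 0 ≤ f U S := fun U S => by simp only [hf]; split_ifs <;> norm_num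
  have hU : ∀ U ∈ Finset.powersetCard M (Finset.univ : Finset (Fin n)),
      -- The 2 comes from `cliqueFactor` having 2^(k+3) rather than 2^(k+2); half of the exponent
      -- pays for the at most n^M choices of U.
      binomExp E p (f U) ≤ Real.exp (-(2 * Real.log n * M)) := by
    intro U hU
    have hUM := (Finset.mem_powersetCard.1 hU).2
    refine (binomExp_no_clique_le hp p.2.2 (Φ := cliqueFactor k * Real.log n * M) (by positivity) hk
      (hUM ▸ hM) (fun j hj hjk => ?_) (cliqueEdges_mono (Finset.subset_univ U))).trans
      (Real.exp_le_exp.2 (le_of_eq ?_))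
    · rw [hUM]
      refine le_pow_mul_pow_choose hp hM0 ?_ hk' p.2.2 hj hjk
      nlinarith
    · have : (k : ℝ) ^ k * k.factorial ≠ 0 := by positivity
      unfold cliqueFactor
      field_simp
      ring
  calc _ ≤ binomExp E p (fun S =>
          ∑ U ∈ Finset.powersetCard M (Finset.univ : Finset (Fin n)), f U S) := by
        refine binomialRandom_real_le_binomExp p _ (fun S => Finset.sum_nonneg fun U _ => hf0 U S) ?_
        rintro G ⟨U, hUM, hQ⟩ S hS
        have h1 : f U S = 1 := by
          refine if_neg ?_
          rintro ⟨Q, hQU, hQE⟩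
          obtain ⟨hQU, hQk⟩ := Finset.mem_powersetCard.1 hQU
          refine hQ Q hQU ⟨coe_cliqueEdges_subset_edgeSet.1 ?_, hQk⟩
          rw [← hS]
          exact Finset.coe_subset.2 hQE
        rw [← h1]
        exact Finset.single_le_sum (f := fun U => f U S) (fun U _ => hf0 U _)
          (Finset.mem_powersetCard.2 ⟨Finset.subset_univ U, hUM⟩)
    _ ≤ (n : ℝ) ^ M * Real.exp (-(2 * Real.log n * M)) := by
        rw [binomExp_sum]
        refine (Finset.sum_le_card_nsmul _ _ _ hU).trans ?_
        rw [nsmul_eq_mul, Finset.card_powersetCard, Finset.card_univ, Fintype.card_fin]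
        gcongr
        exact_mod_cast Nat.choose_le_pow n M
    _ = Real.exp (-(Real.log n * M)) := by
        rw [← Real.exp_log (show (0 : ℝ) < n by exact_mod_cast (by omega : 0 < n)),
          ← Real.exp_nat_mul, ← Real.exp_add, Real.exp_log (by positivity)]
        congr 1
        ring
    _ ≤ _ := by
        have : (1 : ℝ) ≤ M := by exact_mod_cast (by omega : 1 ≤ M)
        exact Real.exp_le_exp.2 (neg_le_neg (le_mul_of_one_le_right hlog.le this))

theorem natCast_le_cliqueFactor {k : ℕ} (hk : 1 ≤ k) : (k : ℝ) ≤ cliqueFactor k := by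
  have h1 : k ≤ 2 ^ (k + 3) * (k ^ k * k.factorial) := by
    refine (Nat.lt_two_pow_self.le.trans (Nat.pow_le_pow_right two_pos (by omega))).trans
      (Nat.le_mul_of_pos_right _ ?_)
    positivity
  unfold cliqueFactor
  exact_mod_cast h1

/-- If every set of `M n` vertices is expected to contain many cliques `K_k`, then with high
probability `G(n, p)` has few orientations without strongly connected copies of `K_{k+1}`. -/
theorem tendsto_numOrientations_le_exp {k : ℕ} (hk : 2 ≤ k) (p : ℕ → unitInterval) (M : ℕ → ℕ)
    (B : ℕ → ℝ)
    (h : ∀ᶠ n : ℕ in atTop, 0 < (p n : ℝ) ∧ k ≤ M n ∧ cliqueFactor k * Real.log n ≤ M n * p n ∧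
      cliqueFactor k * Real.log n * M n ≤ (M n : ℝ) ^ k * (p n : ℝ) ^ k.choose 2 ∧
      M n * n * Real.log n ≤ B n) :
    Tendsto (fun n : ℕ => G(Fin n, p n) {G : SimpleGraph (Fin n) |
      (numOrientations (k + 1) G : ℝ) ≤ Real.exp (B n)}) atTop (𝓝 1) := by
  have hlim : Tendsto (fun n : ℕ => 1 - ENNReal.ofReal (Real.exp (-Real.log n))) atTop (𝓝 1) := by
    have h0 : Tendsto (fun n : ℕ => Real.exp (-Real.log n)) atTop (𝓝 0) :=
      Real.tendsto_exp_neg_atTop_nhds_zero.comp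
        (Real.tendsto_log_atTop.comp tendsto_natCast_atTop_atTop)
    have h1 := ENNReal.tendsto_ofReal h0
    rw [ENNReal.ofReal_zero] at h1
    simpa using ENNReal.Tendsto.sub (tendsto_const_nhds (x := (1 : ENNReal))) h1 (by simp)
  refine tendsto_of_tendsto_of_tendsto_of_le_of_le' hlim tendsto_const_nhds ?_
    (.of_forall fun n => MeasureTheory.prob_le_one)
  filter_upwards [h, eventually_gt_atTop 1] with n ⟨hp, hM, h2, hk', hB⟩ hn
  set bad : Set (SimpleGraph (Fin n)) :=
    {G | ∃ U : Finset (Fin n), U.card = M n ∧ ∀ Q ⊆ U, ¬ G.IsNClique k Q} with hbad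
  have hcover : Set.univ ⊆ {G : SimpleGraph (Fin n) |
      (numOrientations (k + 1) G : ℝ) ≤ Real.exp (B n)} ∪ bad := by
    intro G _
    by_cases hG : G ∈ bad
    · exact .inr hG
    · refine .inl ?_
      simp only [hbad, Set.mem_ofPred_eq] at hG
      push Not at hG
      have hcount := numOrientations_le_pow (by simpa using Nat.succ_le_iff.2 hn) G hk hG
      rw [Fintype.card_fin, ← pow_mul] at hcount
      calc (numOrientations (k + 1) G : ℝ) ≤ (n : ℝ) ^ (M n * n) := mod_cast hcount
        _ = Real.exp (M n * n * Real.log n) := by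
          rw [← Nat.cast_mul, Real.exp_nat_mul, Real.exp_log (by exact_mod_cast (by omega : 0 < n))]
        _ ≤ _ := Real.exp_le_exp.2 hB
  have hone := (MeasureTheory.measure_mono (μ := G(Fin n, p n)) hcover).trans
    (MeasureTheory.measure_union_le _ _)
  rw [MeasureTheory.measure_univ] at hone
  refine (tsub_le_tsub_left ?_ _).trans (tsub_le_iff_right.2 hone)
  rw [← MeasureTheory.ofReal_measureReal]
  exact ENNReal.ofReal_le_ofReal
    (binomialRandom_real_exists_cliqueFree_le hn hk hM (p n) hp h2 hk')

/-- With M about K x, the two hypotheses on x are the conditions for j = 2 and j = k, the latter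
after dividing by M and taking a (k-1)-th root. -/
theorem tendsto_numOrientations_le_exp_mul {k : ℕ} (hk : 2 ≤ k) (p : ℕ → unitInterval) (x : ℕ → ℝ)
    (h : ∀ᶠ n : ℕ in atTop, 0 < (p n : ℝ) ∧ Real.log n ≤ x n * p n ∧
      Real.log n ^ (1 / ((k : ℝ) - 1)) ≤ x n * (p n : ℝ) ^ ((k : ℝ) / 2)) :
    Tendsto (fun n : ℕ => G(Fin n, p n) {G : SimpleGraph (Fin n) |
      (numOrientations (k + 1) G : ℝ) ≤
        Real.exp (2 * cliqueFactor k * x n * n * Real.log n)}) atTop (𝓝 1) := by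
  have hlog : ∀ᶠ n : ℕ in atTop, 1 ≤ Real.log n :=
    (Real.tendsto_log_atTop.comp tendsto_natCast_atTop_atTop).eventually_ge_atTop 1
  refine tendsto_numOrientations_le_exp hk p (fun n => ⌈cliqueFactor k * x n⌉₊) _ ?_
  filter_upwards [h, hlog] with n ⟨hp, hxp, hxk⟩ hl
  have hk2 : (2 : ℝ) ≤ k := mod_cast hk
  have hkK := natCast_le_cliqueFactor (show 1 ≤ k by omega)
  set K := cliqueFactor k
  set ℓ := Real.log n
  have hK0 : 0 < K := by linarith
  have hK1 : 1 ≤ K := by linarith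
  have hp1 : (p n : ℝ) ≤ 1 := (p n).2.2
  have hx : 1 ≤ x n := by
    have : 0 < x n := pos_of_mul_pos_left (lt_of_lt_of_le (by linarith) hxp) hp.le
    nlinarith
  have hKx : K ≤ K * x n := le_mul_of_one_le_right hK0.le hx
  have hM := Nat.le_ceil (K * x n)
  have hMlt := Nat.ceil_lt_add_one (hK0.le.trans hKx)
  set M := ⌈K * x n⌉₊
  refine ⟨hp, ?_, ?_, ?_, ?_⟩
  · exact_mod_cast (hkK.trans hKx).trans hM
  · calc K * ℓ ≤ K * (x n * p n) := by gcongr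
      _ = K * x n * p n := by ring
      _ ≤ _ := by gcongr
  · obtain ⟨d, rfl⟩ : ∃ d, k = d + 1 := ⟨k - 1, by omega⟩
    have hd1 : 1 ≤ d := by omega
    have hd : (0 : ℝ) < d := mod_cast hd1
    push_cast at hxk hk2 ⊢
    rw [add_sub_cancel_right] at hxk
    have hpow : (p n : ℝ) ^ (d + 1).choose 2 = ((p n : ℝ) ^ (((d : ℝ) + 1) / 2)) ^ d := by
      rw [← Real.rpow_natCast, ← Real.rpow_natCast, ← Real.rpow_mul hp.le, Nat.cast_choose_two]
      congr 1
      push_cast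
      ring
    have hℓ : (ℓ ^ (1 / (d : ℝ))) ^ d = ℓ := by
      rw [← Real.rpow_natCast, ← Real.rpow_mul (by linarith), one_div, inv_mul_cancel₀ hd.ne',
        Real.rpow_one]
    have hKd : K ≤ K ^ d := le_self_pow₀ hK1 (by omega)
    calc K * ℓ * M ≤ K ^ d * ℓ * M := by gcongr
      _ = (K * ℓ ^ (1 / (d : ℝ))) ^ d * M := by rw [mul_pow, hℓ]
      _ ≤ (M * (p n : ℝ) ^ (((d : ℝ) + 1) / 2)) ^ d * M := by
        gcongr ?_ ^ d * _
        calc _ ≤ K * (x n * (p n : ℝ) ^ (((d : ℝ) + 1) / 2)) := by gcongr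
          _ = K * x n * (p n : ℝ) ^ (((d : ℝ) + 1) / 2) := by ring
          _ ≤ _ := by gcongr
      _ = _ := by rw [hpow, mul_pow]; ring
  · have hM2 : (M : ℝ) ≤ 2 * K * x n := by linarith
    gcongr

theorem mainTheorem9 (r : ℕ) (hr : 4 ≤ r) :
    (∃ C : ℝ, 0 < C ∧ ∀ p : ℕ → unitInterval,
      (fun n : ℕ => (n : ℝ) ^ (-2 / ((r : ℝ) + 1))) =o[atTop] (fun n : ℕ => (p n : ℝ)) →
      (∀ᶠ n : ℕ in atTop, (p n : ℝ) ≤ Real.log n ^ (-2 / ((r : ℝ) - 2))) →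
      Tendsto (fun n : ℕ => G(Fin n, p n) {G : SimpleGraph (Fin n) |
        (numOrientations r G : ℝ) ≤
          Real.exp (C * ((n : ℝ) * Real.log n ^ (1 + 1 / ((r : ℝ) - 2))) /
            (p n : ℝ) ^ (((r : ℝ) - 1) / 2))}) atTop (𝓝 1)) ∧
    (∃ C : ℝ, 0 < C ∧ ∀ p : ℕ → unitInterval,
      (∀ᶠ n : ℕ in atTop, Real.log n ^ (-2 / ((r : ℝ) - 2)) < (p n : ℝ)) →
      Tendsto (fun n : ℕ => G(Fin n, p n) {G : SimpleGraph (Fin n) |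
        (numOrientations r G : ℝ) ≤
          Real.exp (C * ((n : ℝ) * Real.log n ^ 2) / (p n : ℝ))}) atTop (𝓝 1)) := by
  obtain ⟨k, rfl⟩ : ∃ k, r = k + 1 := ⟨r - 1, by omega⟩
  have hk3 : (3 : ℝ) ≤ k := mod_cast (by omega : 3 ≤ k)
  have e1 : ((k + 1 : ℕ) : ℝ) - 2 = k - 1 := by push_cast; ring
  have e2 : ((k + 1 : ℕ) : ℝ) - 1 = k := by push_cast; ring
  rw [e1, e2]
  have hC : 0 < 2 * cliqueFactor k := by unfold cliqueFactor; positivity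
  have hk1 : (0 : ℝ) < k - 1 := by linarith
  have hlog : ∀ᶠ n : ℕ in atTop, 1 ≤ Real.log n :=
    (Real.tendsto_log_atTop.comp tendsto_natCast_atTop_atTop).eventually_ge_atTop 1
  -- At p = ℓ^(-2/(k-1)) the two lower bounds on x agree; comparing p with this value shows which
  -- one dominates.
  have hexp : ∀ ℓ : ℝ, 0 < ℓ →
      (ℓ ^ (-2 / ((k : ℝ) - 1))) ^ (((k : ℝ) - 2) / 2) * ℓ = ℓ ^ (1 / ((k : ℝ) - 1)) := by
    intro ℓ hℓ
    rw [← Real.rpow_mul hℓ.le, ← Real.rpow_add_one hℓ.ne']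
    congr 1
    field_simp
    ring
  have hhalf : ∀ q : ℝ, 0 < q → q ^ ((k : ℝ) / 2) = q ^ (((k : ℝ) - 2) / 2) * q := by
    intro q hq
    rw [← Real.rpow_add_one hq.ne']
    congr 1
    ring
  refine ⟨⟨_, hC, fun p hp0 hp => ?_⟩, ⟨_, hC, fun p hp => ?_⟩⟩
  · refine (tendsto_numOrientations_le_exp_mul (show 2 ≤ k by omega) p (fun n =>
      Real.log n ^ (1 / ((k : ℝ) - 1)) / (p n : ℝ) ^ ((k : ℝ) / 2)) ?_).congr' ?_
    · filter_upwards [hlog, hp, hp0.bound one_pos, eventually_gt_atTop 0] with n hl hpn hn0 hn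
      have hp0 : 0 < (p n : ℝ) := by
        have h1 : 0 < (n : ℝ) ^ (-2 / (((k + 1 : ℕ) : ℝ) + 1)) :=
          Real.rpow_pos_of_pos (mod_cast hn) _
        rw [one_mul, Real.norm_of_nonneg h1.le, Real.norm_of_nonneg (p n).2.1] at hn0
        exact h1.trans_le hn0
      have hl0 : 0 < Real.log n := by linarith
      have hpk : 0 < (p n : ℝ) ^ ((k : ℝ) / 2) := Real.rpow_pos_of_pos hp0 _
      refine ⟨hp0, ?_, (div_mul_cancel₀ _ hpk.ne').ge⟩
      rw [div_mul_eq_mul_div, le_div_iff₀ hpk, hhalf _ hp0, ← hexp _ hl0]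
      have := Real.rpow_le_rpow hp0.le hpn (show 0 ≤ ((k : ℝ) - 2) / 2 by linarith)
      calc _ = (p n : ℝ) ^ (((k : ℝ) - 2) / 2) * Real.log n * p n := by ring
        _ ≤ _ := by gcongr
    · filter_upwards [hlog] with n hl
      rw [Real.rpow_add (by linarith), Real.rpow_one]
      congr! 5
      ring
  · refine (tendsto_numOrientations_le_exp_mul (show 2 ≤ k by omega) p (fun n =>
      Real.log n / (p n : ℝ)) ?_).congr ?_
    · filter_upwards [hlog, hp] with n hl hpn
      have hl0 : 0 < Real.log n := by linarith
      have hp0 : 0 < (p n : ℝ) := (Real.rpow_pos_of_pos hl0 _).trans hpn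
      refine ⟨hp0, (div_mul_cancel₀ _ hp0.ne').ge, ?_⟩
      have := Real.rpow_le_rpow (Real.rpow_nonneg hl0.le _) hpn.le
        (show 0 ≤ ((k : ℝ) - 2) / 2 by linarith)
      rw [hhalf _ hp0, ← hexp _ hl0]
      calc _ ≤ (p n : ℝ) ^ (((k : ℝ) - 2) / 2) * Real.log n := by gcongr
        _ = _ := by field_simp
    · intro n
      congr! 5
      ring
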